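/- For $s\ge 1$, $T>0$, $L>0$ and a smooth function $a:[-L,L]\to\mathbb C$ put $$\|a\|_{s,T}:=\sup_{j\ge 0}\ \sup_{|y|\le L}\ \frac{|a^{(j)}(y)|\,T^{j}}{(j!)^{s}}\in[0,\infty],$$ and let $\mathcal G^{s,T}$ on $[-L,L]$ be the class of smooth $a$ with $\|a\|_{s,T}<\infty$ (so that $s=1$ corresponds to analytic symbols). Let $s>1$ and $T_0,T>1$. There is $c=c(T_0,T,s)>0$ such that for every $\delta>0$ there is $C=C(T_0,T,s,\delta)>0$ with the following property: for all $L>0$, all $a\in\mathcal G^{s,T_0}$ on $[-L,L]$, all real $x$ with $\delta\le|x|\le L$ and all $h>0$, $$\left|\int_{-x}^{x} e^{-y^2/h-2iy/h}\,a(y)\,dy\right|\ \le\ C\,h^{1/2}\,\|a\|_{s,T}\,e^{-c/h^{1/s}}$$ (the bound being void if $\|a\|_{s,T}=\infty$; one may take $T=T_0$). For $s=1$ the same holds, except that $c$ may depend on $\delta$ as well. -/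

import Mathlib

open Set MeasureTheory
open scoped Nat ENNReal ContDiff

/-- The Gevrey norm of order `s` and radius `T` of a symbol `a` on the interval `[-L, L]`:
`sup_j sup_{|y| ≤ L} |∂^j a (y)| T^j / (j!)^s`, with value `∞` when the supremum is infinite.
Derivatives at the end points are one-sided. -/
noncomputable def gevreyNorm (s T L : ℝ) (a : ℝ → ℂ) : ℝ≥0∞ :=
  ⨆ j : ℕ, ⨆ y ∈ Icc (-L) L,
    ENNReal.ofReal (‖iteratedDerivWithin j a (Icc (-L) L) y‖ * T ^ j / (j ! : ℝ) ^ s)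

/-- The Gevrey class of order `s` and radius `T` on `[-L, L]`: smooth functions on `[-L, L]`
whose Gevrey norm is finite. -/
def MemGevrey (s T L : ℝ) (a : ℝ → ℂ) : Prop :=
  ContDiffOn ℝ ∞ a (Icc (-L) L) ∧ gevreyNorm s T L a < ⊤

/-- The oscillatory integral `∫_{-x}^{x} exp (-y²/h - 2iy/h) a(y) dy`. -/
noncomputable def oscIntegral (h x : ℝ) (a : ℝ → ℂ) : ℂ :=
  ∫ y in (-x)..x,
    Complex.exp (-(y : ℂ) ^ 2 / (h : ℂ) - 2 * Complex.I * (y : ℂ) / (h : ℂ)) * a y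

open Complex (I reCLM imCLM ofRealCLM)

/-! On `Im z = -η` with `0 ≤ η ≤ 1` the phase is at most `exp (-η/h) exp (-(Re z)²/h)`, so one
shifts the contour down by `η`. As `a` need not be analytic, it is replaced by its Taylor polynomial
of order `n` in `i Im z`, and Green's formula (`contour_shift`) adds an area term carrying the
`(n+1)`-st derivative. The Gevrey bound turns the Taylor terms into powers of `m^(s-1) η` with `m =
n + 1` (`factorial_rpow_mul_pow_div_le`). With `m ≈ h^(-1/s)` and `η = ε h^(1-1/s)` this ratio is at
most `1/4`, while `exp (-η/h)` and `2^(-m)` are both `exp (-c/h^(1/s))` in size. The vertical sides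
contribute `exp (-x²/h) ≤ exp (-δ²/h)`. For `s > 1` this is smaller than `exp (-c/h^(1/s))` up to a
constant, for every `c` (`exists_exp_neg_div_le`); for `s = 1` it limits `c` in terms of `δ`. -/

/-- The Gaussian phase factor `exp (-z²/h - 2iz/h)` as an entire function. -/
noncomputable def gaussPhase (h : ℝ) (z : ℂ) : ℂ :=
  Complex.exp (-z ^ 2 / (h : ℂ) - 2 * I * z / (h : ℂ))

/-- The truncated almost analytic extension `∑_{j ≤ n} b_j (Re z) (i Im z)^j / j!` of a function
with derivatives `b_j`. -/
noncomputable def almostAnalytic (b : ℕ → ℝ → ℂ) (n : ℕ) (z : ℂ) : ℂ :=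
  ∑ j ∈ Finset.range (n + 1), b j z.re * (I * z.im) ^ j / (j ! : ℂ)

/-- The real derivative of `almostAnalytic` when `b (j + 1)` is the derivative of `b j`. -/
noncomputable def almostAnalyticDeriv (b : ℕ → ℝ → ℂ) (n : ℕ) (z : ℂ) : ℂ →L[ℝ] ℂ :=
  ∑ j ∈ Finset.range (n + 1),
    (reCLM.smulRight (b (j + 1) z.re * (I * z.im) ^ j / (j ! : ℂ)) +
      imCLM.smulRight (b j z.re * (j * (I * z.im) ^ (j - 1) * I) / (j ! : ℂ)))

/-! ### Derivatives of the phase and of the almost analytic extension; contour shift. -/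

theorem hasDerivAt_gaussPhase (h : ℝ) (z : ℂ) :
    HasDerivAt (gaussPhase h) (gaussPhase h z * (-(2 * z) / h - 2 * I / h)) z := by
  have h1 : HasDerivAt (fun z : ℂ => -z ^ 2 / (h : ℂ) - 2 * I * z / (h : ℂ))
      (-(2 * z) / h - 2 * I / h) z := by
    have := (((hasDerivAt_pow 2 z).neg).div_const (h : ℂ)).sub
      (((hasDerivAt_id z).const_mul (2 * I)).div_const (h : ℂ))
    exact this.congr_deriv (by simp)
  exact h1.cexp

theorem continuous_gaussPhase (h : ℝ) : Continuous (gaussPhase h) := by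
  unfold gaussPhase
  fun_prop

theorem norm_gaussPhase_le {h : ℝ} (hh : 0 < h) {z : ℂ} (h0 : z.im ≤ 0) (h1 : -1 ≤ z.im) :
    ‖gaussPhase h z‖ ≤ Real.exp (z.im / h) * Real.exp (-(1 / h) * z.re ^ 2) := by
  have : (-z ^ 2 / (h : ℂ) - 2 * I * z / (h : ℂ)).re
      = (-z.re ^ 2 + z.im ^ 2 + 2 * z.im) / h := by
    rw [← sub_div, Complex.div_ofReal_re]
    simp [pow_two]
    ring
  rw [gaussPhase, Complex.norm_exp, this, ← Real.exp_add, Real.exp_le_exp]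
  have e : z.im / h + -(1 / h) * z.re ^ 2 = (z.im - z.re ^ 2) / h := by ring
  rw [e]
  gcongr
  -- With `t = z.im` in `[-1, 0]` this is `t² + 2t ≤ t`.
  nlinarith

theorem hasFDerivAt_almostAnalytic {b : ℕ → ℝ → ℂ} {z : ℂ}
    (hb : ∀ j, HasDerivAt (b j) (b (j + 1) z.re) z.re) (n : ℕ) :
    HasFDerivAt (almostAnalytic b n) (almostAnalyticDeriv b n z) z := by
  unfold almostAnalytic almostAnalyticDeriv
  refine HasFDerivAt.fun_sum fun j _ => ?_
  have h1 : HasFDerivAt (fun z : ℂ => b j z.re) _ z :=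
    (hb j).hasFDerivAt.comp z reCLM.hasFDerivAt
  have h2 : HasFDerivAt (fun z : ℂ => I * (z.im : ℂ)) (I • (ofRealCLM.comp imCLM)) z :=
    ((ofRealCLM.comp imCLM).hasFDerivAt (x := z)).const_mul I
  have h3 := (h1.mul (h2.pow j)).mul_const ((j ! : ℂ)⁻¹)
  simp only [div_eq_mul_inv]
  refine h3.congr_fderiv ?_
  ext v
  simp
  ring

/-- The antiholomorphic derivative of the almost analytic extension telescopes. -/
theorem dbar_almostAnalyticDeriv (b : ℕ → ℝ → ℂ) (n : ℕ) (z : ℂ) :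
    I * almostAnalyticDeriv b n z 1 - almostAnalyticDeriv b n z I =
      I * (b (n + 1) z.re * (I * z.im) ^ n / (n ! : ℂ)) := by
  induction n with
  | zero => simp [almostAnalyticDeriv]
  | succ n ih =>
    have e : almostAnalyticDeriv b (n + 1) z = almostAnalyticDeriv b n z +
        (reCLM.smulRight (b (n + 2) z.re * (I * z.im) ^ (n + 1) / ((n + 1)! : ℂ)) +
      imCLM.smulRight (b (n + 1) z.re * ((n + 1 : ℕ) * (I * z.im) ^ n * I) / ((n + 1)! : ℂ))) := by
      rw [almostAnalyticDeriv, Finset.sum_range_succ]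
      rfl
    have hn : (n ! : ℂ) ≠ 0 := by exact_mod_cast n.factorial_ne_zero
    have hn' : (n + 1 : ℂ) ≠ 0 := by exact_mod_cast n.succ_ne_zero
    rw [e]
    simp only [add_apply, mul_add, ContinuousLinearMap.smulRight_apply, Complex.reCLM_apply,
      Complex.imCLM_apply, Complex.one_re, Complex.one_im, Complex.I_re, Complex.I_im, one_smul,
      zero_smul, add_zero, zero_add, Nat.factorial_succ, Nat.cast_mul]
    have : ∀ p q r u : ℂ, p + q - (r + u) = p - r + (q - u) := by intros; ring
    rw [this, ih]
    push_cast
    field_simp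
    ring

theorem continuousOn_almostAnalytic_term {b : ℕ → ℝ → ℂ} {L : ℝ} {S : Set ℂ} {i : ℕ}
    (hb : ContinuousOn (b i) (Icc (-L) L)) (hS : ∀ z ∈ S, z.re ∈ Icc (-L) L) (j : ℕ) :
    ContinuousOn (fun z : ℂ => b i z.re * (I * z.im) ^ j / (j ! : ℂ)) S := by
  have h1 : ContinuousOn (fun z : ℂ => b i z.re) S :=
    hb.comp Complex.continuous_re.continuousOn hS
  have h2 : ContinuousOn (fun z : ℂ => (I * z.im) ^ j) S := by
    apply Continuous.continuousOn
    fun_prop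
  exact (h1.mul h2).div_const _

/-- Shifting the contour from `[-x, x]` to `[-x, x] - iη` for an almost analytic extension. -/
theorem contour_shift {b : ℕ → ℝ → ℂ} {L x η : ℝ} (h : ℝ) (hx : 0 ≤ x) (hxL : x ≤ L)
    (hc : ∀ j, ContinuousOn (b j) (Icc (-L) L))
    (hd : ∀ j, ∀ y ∈ Ioo (-L) L, HasDerivAt (b j) (b (j + 1) y) y) (n : ℕ) :
    (∫ y in (-x)..x, gaussPhase h ⟨y, -η⟩ * almostAnalytic b n ⟨y, -η⟩) -
      (∫ y in (-x)..x, gaussPhase h y * b 0 y) +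
      I * (∫ t in (-η)..0, gaussPhase h ⟨x, t⟩ * almostAnalytic b n ⟨x, t⟩) -
      I * (∫ t in (-η)..0, gaussPhase h ⟨-x, t⟩ * almostAnalytic b n ⟨-x, t⟩) =
    ∫ y in (-x)..x, ∫ t in (-η)..0,
      gaussPhase h ⟨y, t⟩ * (I * (b (n + 1) y * (I * t) ^ n / (n ! : ℂ))) := by
  have hS : ∀ z ∈ uIcc (-x) x ×ℂ uIcc (-η) 0, z.re ∈ Icc (-L) L := by
    intro z hz
    rw [Complex.mem_reProdIm, uIcc_of_le (by linarith)] at hz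
    exact ⟨by linarith [hz.1.1], by linarith [hz.1.2]⟩
  set f' : ℂ → ℂ →L[ℝ] ℂ := fun z => gaussPhase h z • almostAnalyticDeriv b n z +
    almostAnalytic b n z •
      ((ContinuousLinearMap.toSpanSingleton ℂ
        (gaussPhase h z * (-(2 * z) / h - 2 * I / h))).restrictScalars ℝ) with hf'
  -- The phase is holomorphic, so only the telescoped remainder of the extension survives.
  have hdbar : ∀ z, I • f' z 1 - f' z I =
      gaussPhase h z * (I * (b (n + 1) z.re * (I * z.im) ^ n / (n ! : ℂ))) := by
    intro z
    rw [← dbar_almostAnalyticDeriv]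
    simp only [hf', add_apply, smul_apply, smul_eq_mul,
      ContinuousLinearMap.coe_restrictScalars', ContinuousLinearMap.toSpanSingleton_apply]
    ring
  have key := Complex.integral_boundary_rect_of_hasFDerivAt_real_off_countable
    (fun z => gaussPhase h z * almostAnalytic b n z) f' ⟨-x, -η⟩ ⟨x, 0⟩ ∅ countable_empty ?_ ?_ ?_
  · simp only [hdbar] at key
    have e0 : ∀ y : ℝ, almostAnalytic b n y = b 0 y := by
      intro y
      rw [almostAnalytic, Finset.sum_range_succ']
      simp
    have e1 : ∀ y t : ℝ, (y : ℂ) + t * I = ⟨y, t⟩ := fun y t => (Complex.mk_eq_add_mul_I y t).symm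
    simp only [smul_eq_mul, e1] at key
    have e2 : ∀ y : ℝ, (⟨y, 0⟩ : ℂ) = y := fun y => rfl
    simp only [e2, e0] at key
    exact key
  · refine (continuous_gaussPhase h).continuousOn.mul ?_
    exact continuousOn_finsetSum _ fun j _ => continuousOn_almostAnalytic_term (hc j) hS j
  · intro z hz
    have hz' : z.re ∈ Ioo (-L) L := by
      have := hz.1.1
      simp only [mem_preimage, min_eq_left (show -x ≤ x by linarith),
        max_eq_right (show -x ≤ x by linarith)] at this
      exact ⟨by linarith [this.1], by linarith [this.2]⟩
    have h1 := (hasDerivAt_gaussPhase h z).hasFDerivAt.restrictScalars ℝ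
    exact h1.mul (hasFDerivAt_almostAnalytic (fun j => hd j _ hz') n)
  · simp only [hdbar]
    refine ContinuousOn.integrableOn_compact (isCompact_uIcc.reProdIm isCompact_uIcc) ?_
    exact (continuous_gaussPhase h).continuousOn.mul
      (continuousOn_const.mul (continuousOn_almostAnalytic_term (hc _) hS n))

/-! ### Bounds on the pieces of the contour. -/

/-- Enlarging the domain to the whole line gives the factor `h^(1/2)` and uniformity in `x` and `L`.
-/
theorem norm_integral_le_of_norm_le_gaussian {f : ℝ → ℂ} {x h K : ℝ} (hx : 0 ≤ x) (hh : 0 < h)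
    (hK : 0 ≤ K) (hf : ∀ y ∈ Icc (-x) x, ‖f y‖ ≤ K * Real.exp (-(1 / h) * y ^ 2)) :
    ‖∫ y in (-x)..x, f y‖ ≤ K * √(Real.pi * h) := by
  have hi : Integrable fun y : ℝ => K * Real.exp (-(1 / h) * y ^ 2) :=
    (integrable_exp_neg_mul_sq (by positivity)).const_mul K
  refine (intervalIntegral.norm_integral_le_of_norm_le (by linarith)
    (ae_of_all _ fun y hy => hf y (Ioc_subset_Icc_self hy)) hi.intervalIntegrable).trans ?_
  rw [intervalIntegral.integral_of_le (by linarith)]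
  refine (setIntegral_le_integral hi (ae_of_all _ fun y => by positivity)).trans ?_
  rw [integral_const_mul, integral_gaussian]
  simp

/-- The Taylor denominator cancels one power of `j !`, and `j ! ≤ m^j` controls the remaining power
`s - 1`. The Taylor series is thus dominated by a geometric one up to order `m`. -/
theorem factorial_rpow_mul_pow_div_le {s t : ℝ} (hs : 1 ≤ s) (ht : 0 ≤ t) {j m : ℕ} (hj : j ≤ m) :
    (j ! : ℝ) ^ s * t ^ j / (j ! : ℝ) ≤ ((m : ℝ) ^ (s - 1) * t) ^ j := by
  have hf : (0 : ℝ) < j ! := by exact_mod_cast j.factorial_pos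
  have e : (j ! : ℝ) ^ s * t ^ j / (j ! : ℝ) = (j ! : ℝ) ^ (s - 1) * t ^ j := by
    rw [Real.rpow_sub_one hf.ne']
    ring
  rw [e, mul_pow]
  gcongr
  have h1 : (j ! : ℝ) ≤ (m : ℝ) ^ j := by
    exact_mod_cast (Nat.factorial_le_pow j).trans (Nat.pow_le_pow_left hj j)
  calc (j ! : ℝ) ^ (s - 1) ≤ ((m : ℝ) ^ j) ^ (s - 1) :=
        Real.rpow_le_rpow hf.le h1 (by linarith)
    _ = ((m : ℝ) ^ (s - 1)) ^ j := by
        rw [← Real.rpow_natCast_mul (by positivity), ← Real.rpow_mul_natCast (by positivity),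
          mul_comm]

theorem norm_almostAnalytic_le {b : ℕ → ℝ → ℂ} {s A : ℝ} {n : ℕ} {z : ℂ} (hs : 1 ≤ s)
    (hA : 0 ≤ A) (hb : ∀ j, ‖b j z.re‖ ≤ A * (j ! : ℝ) ^ s)
    (hz : ((n + 1 : ℕ) : ℝ) ^ (s - 1) * |z.im| ≤ 1 / 2) :
    ‖almostAnalytic b n z‖ ≤ 2 * A := by
  calc ‖almostAnalytic b n z‖ ≤ ∑ j ∈ Finset.range (n + 1), A * (1 / 2 : ℝ) ^ j := by
        refine norm_sum_le_of_le _ fun j hj => ?_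
        have h1 := factorial_rpow_mul_pow_div_le hs (abs_nonneg z.im) (Finset.mem_range.1 hj).le
        have h2 : (((n + 1 : ℕ) : ℝ) ^ (s - 1) * |z.im|) ^ j ≤ (1 / 2) ^ j :=
          pow_le_pow_left₀ (by positivity) hz j
        simp only [norm_div, norm_mul, norm_pow, Complex.norm_I, one_mul, Complex.norm_real,
          Real.norm_eq_abs, Complex.norm_natCast]
        calc ‖b j z.re‖ * |z.im| ^ j / (j ! : ℝ)
            ≤ A * (j ! : ℝ) ^ s * |z.im| ^ j / (j ! : ℝ) := by
              gcongr
              exact hb j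
          _ = A * ((j ! : ℝ) ^ s * |z.im| ^ j / (j ! : ℝ)) := by ring
          _ ≤ A * (1 / 2) ^ j := by gcongr; exact h1.trans h2
    _ = A * ∑ j ∈ Finset.range (n + 1), (1 / 2 : ℝ) ^ j := by rw [Finset.mul_sum]
    _ ≤ A * 2 := by
        gcongr
        exact sum_geometric_two_le _
    _ = 2 * A := mul_comm _ _

/-- The three terms come from the shifted segment, the two vertical sides and the area integral. -/
theorem norm_integral_gaussPhase_mul_le {b : ℕ → ℝ → ℂ} {s A L x η h : ℝ} {n : ℕ} (hs : 1 ≤ s)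
    (hA : 0 ≤ A) (hx : 0 ≤ x) (hxL : x ≤ L) (hη : 0 ≤ η) (hη1 : η ≤ 1) (hh : 0 < h)
    (hc : ∀ j, ContinuousOn (b j) (Icc (-L) L))
    (hd : ∀ j, ∀ y ∈ Ioo (-L) L, HasDerivAt (b j) (b (j + 1) y) y)
    (hb : ∀ j, ∀ y ∈ Icc (-L) L, ‖b j y‖ ≤ A * (j ! : ℝ) ^ s)
    (hn : ((n + 1 : ℕ) : ℝ) ^ (s - 1) * η ≤ 1 / 4) :
    ‖∫ y in (-x)..x, gaussPhase h y * b 0 y‖ ≤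
      A * (2 * Real.exp (-η / h) * √(Real.pi * h) + 4 * Real.exp (-(1 / h) * x ^ 2) +
        (1 / 2) ^ (n + 1) * √(Real.pi * h)) := by
  have hext : ∀ y ∈ Icc (-x) x, ∀ t ∈ Icc (-η) 0, ‖almostAnalytic b n ⟨y, t⟩‖ ≤ 2 * A := by
    intro y hy t ht
    refine norm_almostAnalytic_le hs hA
      (fun j => hb j y ⟨by linarith [hy.1], by linarith [hy.2]⟩) ?_
    have : |t| ≤ η := abs_le.2 ⟨ht.1, by linarith [ht.2]⟩
    calc _ ≤ ((n + 1 : ℕ) : ℝ) ^ (s - 1) * η := by gcongr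
      _ ≤ _ := by linarith
  have hphase : ∀ y : ℝ, ∀ t ∈ Icc (-η) 0,
      ‖gaussPhase h ⟨y, t⟩‖ ≤ Real.exp (-(1 / h) * y ^ 2) := by
    intro y t ht
    refine (norm_gaussPhase_le hh ht.2 (by simpa using (by linarith [ht.1] : -1 ≤ t))).trans ?_
    refine mul_le_of_le_one_left (by positivity) (Real.exp_le_one_iff.2 ?_)
    exact div_nonpos_of_nonpos_of_nonneg ht.2 hh.le
  have hbottom : ‖∫ y in (-x)..x, gaussPhase h ⟨y, -η⟩ * almostAnalytic b n ⟨y, -η⟩‖ ≤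
      (2 * A * Real.exp (-η / h)) * √(Real.pi * h) := by
    refine norm_integral_le_of_norm_le_gaussian hx hh (by positivity) fun y hy => ?_
    rw [norm_mul]
    calc _ ≤ (Real.exp (-η / h) * Real.exp (-(1 / h) * y ^ 2)) * (2 * A) := by
          gcongr
          · exact norm_gaussPhase_le (z := ⟨y, -η⟩) hh (by simpa using hη) (by simpa using hη1)
          · exact hext y hy _ ⟨le_rfl, by linarith⟩
      _ = _ := by ring
  have hside : ∀ u ∈ Icc (-x) x, u ^ 2 = x ^ 2 →
      ‖I * ∫ t in (-η)..0, gaussPhase h ⟨u, t⟩ * almostAnalytic b n ⟨u, t⟩‖ ≤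
      2 * A * Real.exp (-(1 / h) * x ^ 2) := by
    intro u hu hux
    rw [norm_mul, Complex.norm_I, one_mul]
    have h1 := intervalIntegral.norm_integral_le_of_norm_le_const (a := -η) (b := 0)
      (f := fun t => gaussPhase h ⟨u, t⟩ * almostAnalytic b n ⟨u, t⟩)
      (C := Real.exp (-(1 / h) * x ^ 2) * (2 * A)) ?_
    · refine h1.trans ?_
      rw [sub_neg_eq_add, zero_add, abs_of_nonneg hη]
      calc _ ≤ Real.exp (-(1 / h) * x ^ 2) * (2 * A) * 1 := by gcongr
        _ = _ := by ring
    · intro t ht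
      rw [uIoc_of_le (by linarith)] at ht
      have ht' := Ioc_subset_Icc_self ht
      rw [norm_mul, ← hux]
      gcongr
      · exact hphase u t ht'
      · exact hext u hu t ht'
  have harea : ‖∫ y in (-x)..x, ∫ t in (-η)..0,
      gaussPhase h ⟨y, t⟩ * (I * (b (n + 1) y * (I * t) ^ n / (n ! : ℂ)))‖ ≤
      (A * (1 / 2) ^ (n + 1)) * √(Real.pi * h) := by
    refine norm_integral_le_of_norm_le_gaussian hx hh (by positivity) fun y hy => ?_
    refine (intervalIntegral.norm_integral_le_of_norm_le_const
      (C := Real.exp (-(1 / h) * y ^ 2) * (A * ((n + 1)! : ℝ) ^ s * η ^ n / (n ! : ℝ)))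
      fun t ht => ?_).trans ?_
    · rw [uIoc_of_le (by linarith)] at ht
      have ht' := Ioc_subset_Icc_self ht
      have : |t| ≤ η := abs_le.2 ⟨ht'.1, by linarith [ht'.2]⟩
      simp only [norm_div, norm_mul, norm_pow, Complex.norm_I, one_mul, Complex.norm_real,
          Real.norm_eq_abs, Complex.norm_natCast]
      gcongr
      · exact hphase y t ht'
      · exact hb _ y ⟨by linarith [hy.1], by linarith [hy.2]⟩
    · rw [sub_neg_eq_add, zero_add, abs_of_nonneg hη]
      have h1 := (factorial_rpow_mul_pow_div_le hs hη (le_refl (n + 1))).trans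
        (pow_le_pow_left₀ (by positivity) hn (n + 1))
      have hnf : (n ! : ℝ) ≠ 0 := by exact_mod_cast n.factorial_ne_zero
      -- The `t`-integration supplies the missing power of `η`; passing from `n !` to `(n + 1)!`
      -- costs a factor `n + 1 ≤ 2^(n+1)`. This is why `hn` asks for `1/4` and not `1/2`.
      have h2 : ((n + 1)! : ℝ) ^ s * η ^ n / (n ! : ℝ) * η =
          (n + 1 : ℕ) * (((n + 1)! : ℝ) ^ s * η ^ (n + 1) / ((n + 1)! : ℝ)) := by
        rw [Nat.factorial_succ]
        push_cast
        field_simp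
        ring
      have h3 : ((n + 1 : ℕ) : ℝ) ≤ 2 ^ (n + 1) := by exact_mod_cast Nat.lt_two_pow_self.le
      have h4 : ((n + 1)! : ℝ) ^ s * η ^ n / (n ! : ℝ) * η ≤ (1 / 2) ^ (n + 1) := by
        rw [h2]
        calc _ ≤ (2 : ℝ) ^ (n + 1) * (1 / 4) ^ (n + 1) := by gcongr
          _ = _ := by rw [← mul_pow]; norm_num
      calc _ = A * (((n + 1)! : ℝ) ^ s * η ^ n / (n ! : ℝ) * η) *
            Real.exp (-(1 / h) * y ^ 2) := by ring
        _ ≤ _ := by gcongr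
  have hxx : x ∈ Icc (-x) x := ⟨by linarith, le_rfl⟩
  have hxx' : -x ∈ Icc (-x) x := ⟨le_rfl, by linarith⟩
  have key := contour_shift h hx hxL hc hd n (η := η)
  have hr := hside x hxx rfl
  have hl := hside (-x) hxx' (by ring)
  generalize (∫ y in (-x)..x, gaussPhase h ⟨y, -η⟩ * almostAnalytic b n ⟨y, -η⟩) = p at *
  generalize (∫ y in (-x)..x, gaussPhase h y * b 0 y) = q at *
  generalize (I * ∫ t in (-η)..0, gaussPhase h ⟨x, t⟩ * almostAnalytic b n ⟨x, t⟩) = r at *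
  generalize (I * ∫ t in (-η)..0, gaussPhase h ⟨-x, t⟩ * almostAnalytic b n ⟨-x, t⟩) = l at *
  rw [← key] at harea
  have e : q = p + r - l - (p - q + r - l) := by ring
  calc ‖q‖ = ‖p + r - l - (p - q + r - l)‖ := by rw [← e]
    _ ≤ ‖p‖ + ‖r‖ + ‖l‖ + ‖p - q + r - l‖ :=
        (norm_sub_le _ _).trans (add_le_add_left ((norm_sub_le _ _).trans
          (add_le_add_left (norm_add_le _ _) _)) _)
    _ ≤ _ := by linarith

/-! ### From the Gevrey norm to derivative bounds; sign of `x`; the unshifted bound. -/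

theorem norm_iteratedDerivWithin_le_gevreyNorm {s T L y : ℝ} {a : ℝ → ℂ} (hT : 1 ≤ T)
    (ha : gevreyNorm s T L a ≠ ⊤) (hy : y ∈ Icc (-L) L) (j : ℕ) :
    ‖iteratedDerivWithin j a (Icc (-L) L) y‖ ≤ (gevreyNorm s T L a).toReal * (j ! : ℝ) ^ s := by
  have hf : (0 : ℝ) < (j ! : ℝ) ^ s :=
    Real.rpow_pos_of_pos (by exact_mod_cast j.factorial_pos) _
  have h1 : ENNReal.ofReal (‖iteratedDerivWithin j a (Icc (-L) L) y‖ * T ^ j / (j ! : ℝ) ^ s) ≤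
      gevreyNorm s T L a :=
    le_iSup_of_le j (le_iSup₂_of_le y hy le_rfl)
  rw [ENNReal.ofReal_le_iff_le_toReal ha, div_le_iff₀ hf] at h1
  exact (le_mul_of_one_le_right (norm_nonneg _) (one_le_pow₀ hT)).trans h1

theorem oscIntegral_neg (h x : ℝ) (a : ℝ → ℂ) : oscIntegral h (-x) a = -oscIntegral h x a := by
  rw [oscIntegral, oscIntegral, neg_neg, intervalIntegral.integral_symm]

theorem norm_oscIntegral_abs (h x : ℝ) (a : ℝ → ℂ) :
    ‖oscIntegral h |x| a‖ = ‖oscIntegral h x a‖ := by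
  rcases abs_choice x with e | e <;> rw [e]
  rw [oscIntegral_neg, norm_neg]

theorem hasDerivAt_iteratedDerivWithin {a : ℝ → ℂ} {L y : ℝ} (ha : ContDiffOn ℝ ∞ a (Icc (-L) L))
    (hy : y ∈ Ioo (-L) L) (j : ℕ) :
    HasDerivAt (iteratedDerivWithin j a (Icc (-L) L))
      (iteratedDerivWithin (j + 1) a (Icc (-L) L) y) y := by
  have hu : UniqueDiffOn ℝ (Icc (-L) L) := uniqueDiffOn_Icc (hy.1.trans hy.2)
  have h1 := (ha.differentiableOn_iteratedDerivWithin (m := j)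
    (by exact_mod_cast WithTop.coe_lt_top (j : ℕ)) hu y (Ioo_subset_Icc_self hy)).hasDerivWithinAt
  rw [iteratedDerivWithin_succ]
  exact h1.hasDerivAt (Icc_mem_nhds hy.1 hy.2)

/-- Without any shift; enough for `h ≥ 1`, where the exponential factor is bounded below. -/
theorem norm_oscIntegral_le_sqrt {a : ℝ → ℂ} {A x h : ℝ} (hA : 0 ≤ A) (hx : 0 ≤ x) (hh : 0 < h)
    (ha : ∀ y ∈ Icc (-x) x, ‖a y‖ ≤ A) : ‖oscIntegral h x a‖ ≤ A * √(Real.pi * h) := by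
  refine norm_integral_le_of_norm_le_gaussian hx hh hA fun y hy => ?_
  rw [norm_mul, mul_comm]
  refine mul_le_mul (ha y hy) ?_ (norm_nonneg _) hA
  simpa [gaussPhase] using norm_gaussPhase_le (z := (y : ℂ)) hh (by simp) (by simp)

/-! ### The regime `h ≤ 1`: choice of `η` and `n`. -/

/-- Half of the exponent `δ²/h` is spent, through `exp (-u) ≤ 1/u`, on a factor `h ≤ h^(1/2)`. -/
theorem four_mul_exp_neg_le {δ x h : ℝ} (hδ : 0 < δ) (hx : δ ≤ x) (hh : 0 < h) (hh1 : h ≤ 1) :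
    4 * Real.exp (-(1 / h) * x ^ 2) ≤
      h ^ (1 / 2 : ℝ) * (8 / δ ^ 2 * Real.exp (-(δ ^ 2 / 2) / h)) := by
  have h1 : h ≤ h ^ (1 / 2 : ℝ) := by
    simpa using Real.rpow_le_rpow_of_exponent_ge hh hh1 (show (1 / 2 : ℝ) ≤ 1 by norm_num)
  have h2 : -(1 / h) * x ^ 2 ≤ -(δ ^ 2 / 2 / h) + -(δ ^ 2 / 2) / h := by
    have : δ ^ 2 / h ≤ x ^ 2 / h := by gcongr
    calc _ = -(x ^ 2 / h) := by ring
      _ ≤ -(δ ^ 2 / h) := by linarith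
      _ = _ := by ring
  have h3 : Real.exp (-(δ ^ 2 / 2 / h)) ≤ 2 * h / δ ^ 2 := by
    have h4 : δ ^ 2 / 2 / h ≤ Real.exp (δ ^ 2 / 2 / h) := by
      linarith [Real.add_one_le_exp (δ ^ 2 / 2 / h)]
    rw [Real.exp_neg]
    refine (inv_anti₀ (by positivity) h4).trans (le_of_eq ?_)
    field_simp
  calc _ ≤ 4 * (Real.exp (-(δ ^ 2 / 2 / h)) * Real.exp (-(δ ^ 2 / 2) / h)) := by
        rw [← Real.exp_add]
        gcongr
    _ ≤ 4 * (2 * h / δ ^ 2 * Real.exp (-(δ ^ 2 / 2) / h)) := by gcongr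
    _ = h * (8 / δ ^ 2 * Real.exp (-(δ ^ 2 / 2) / h)) := by ring
    _ ≤ _ := by gcongr

theorem half_pow_ceil_le (v : ℝ) : (1 / 2 : ℝ) ^ ⌈v⌉₊ ≤ Real.exp (-(v / 2)) := by
  have h1 : (1 / 2 : ℝ) ≤ Real.exp (-(1 / 2)) := by
    linarith [Real.add_one_le_exp (-(1 / 2) : ℝ)]
  calc (1 / 2 : ℝ) ^ ⌈v⌉₊ ≤ Real.exp (-(1 / 2)) ^ ⌈v⌉₊ := by gcongr
    _ = Real.exp (⌈v⌉₊ * -(1 / 2)) := (Real.exp_nat_mul _ _).symm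
    _ ≤ _ := by
      rw [Real.exp_le_exp]
      linarith [Nat.le_ceil v]

/-- The bound in the semiclassical regime `h ≤ 1`, with explicit constants. -/
theorem norm_oscIntegral_le_of_le_one {s A L δ x h : ℝ} {a : ℝ → ℂ} (hs : 1 ≤ s) (hA : 0 ≤ A)
    (ha : ContDiffOn ℝ ∞ a (Icc (-L) L))
    (hb : ∀ j, ∀ y ∈ Icc (-L) L, ‖iteratedDerivWithin j a (Icc (-L) L) y‖ ≤ A * (j ! : ℝ) ^ s)
    (hδ : 0 < δ) (hx : δ ≤ x) (hxL : x ≤ L) (hh : 0 < h) (hh1 : h ≤ 1) :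
    ‖oscIntegral h x a‖ ≤ A * h ^ (1 / 2 : ℝ) *
      (3 * √Real.pi * Real.exp (-2 ^ (-(s + 1)) / h ^ (1 / s)) +
        8 / δ ^ 2 * Real.exp (-(δ ^ 2 / 2) / h)) := by
  have hs0 : 0 < s := by linarith
  -- Chosen so that `2^(s-1) ε = 1/4`, the `2^(s-1)` being the loss from `⌈v⌉₊ ≤ 2 v`.
  set ε : ℝ := 2 ^ (-(s + 1)) with hε
  have hε0 : 0 < ε := by positivity
  have hε1 : ε ≤ 1 / 2 := by
    calc ε ≤ (2 : ℝ) ^ (-1 : ℝ) :=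
          Real.rpow_le_rpow_of_exponent_le (by norm_num) (by linarith)
      _ = 1 / 2 := by rw [Real.rpow_neg_one]; norm_num
  set v : ℝ := 1 / h ^ (1 / s) with hv
  have hp : 0 < h ^ (1 / s) := by positivity
  have hv1 : 1 ≤ v := by
    rw [hv, le_div_iff₀ hp, one_mul]
    exact Real.rpow_le_one hh.le hh1 (by positivity)
  -- This power of `h` makes `v^(s-1) η = ε` and `η / h = ε v` at once.
  set η : ℝ := ε * h ^ (1 - 1 / s) with hηdef
  have hη0 : 0 ≤ η := by positivity
  have h1s : 1 / s ≤ 1 := by rw [div_le_one hs0]; exact hs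
  have hη1 : η ≤ 1 := by
    have : h ^ (1 - 1 / s) ≤ 1 := Real.rpow_le_one hh.le hh1 (by linarith)
    nlinarith
  obtain ⟨n, hn⟩ : ∃ n, ⌈v⌉₊ = n + 1 :=
    Nat.exists_eq_succ_of_ne_zero (Nat.ceil_pos.2 (by linarith)).ne'
  have hceil : ((n + 1 : ℕ) : ℝ) ≤ 2 * v := by
    rw [← hn]
    linarith [Nat.ceil_lt_add_one (show 0 ≤ v by linarith)]
  have hsmall : ((n + 1 : ℕ) : ℝ) ^ (s - 1) * η ≤ 1 / 4 := by
    have e1 : v ^ (s - 1) * h ^ (1 - 1 / s) = 1 := by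
      have : v = h ^ (-(1 / s)) := by rw [hv, Real.rpow_neg hh.le, one_div]
      rw [this, ← Real.rpow_mul hh.le, ← Real.rpow_add hh]
      have : -(1 / s) * (s - 1) + (1 - 1 / s) = 0 := by field_simp; ring
      rw [this, Real.rpow_zero]
    have e2 : (2 : ℝ) ^ (s - 1) * ε = 1 / 4 := by
      rw [hε, ← Real.rpow_add (by norm_num)]
      have : s - 1 + -(s + 1) = ((-2 : ℤ) : ℝ) := by push_cast; ring
      rw [this, Real.rpow_intCast]
      norm_num
    calc ((n + 1 : ℕ) : ℝ) ^ (s - 1) * η ≤ (2 * v) ^ (s - 1) * η := by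
          gcongr
      _ = ((2 : ℝ) ^ (s - 1) * ε) * (v ^ (s - 1) * h ^ (1 - 1 / s)) := by
          rw [Real.mul_rpow (by norm_num) (by linarith), hηdef]
          ring
      _ = 1 / 4 := by rw [e1, e2, mul_one]
  have hLL : -L < L := by linarith
  have hu : UniqueDiffOn ℝ (Icc (-L) L) := uniqueDiffOn_Icc hLL
  have key := norm_integral_gaussPhase_mul_le hs hA (hδ.le.trans hx) hxL hη0 hη1 hh
    (fun j => ha.continuousOn_iteratedDerivWithin (m := j) (by exact_mod_cast le_top) hu)
    (fun j y hy => hasDerivAt_iteratedDerivWithin ha hy j) hb hsmall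
  have e0 : oscIntegral h x a =
      ∫ y in (-x)..x, gaussPhase h y * iteratedDerivWithin 0 a (Icc (-L) L) y := by
    simp [oscIntegral, gaussPhase]
  have e3 : -η / h = -ε / h ^ (1 / s) := by
    rw [hηdef, Real.rpow_sub hh, Real.rpow_one]
    field_simp
  have h4 : (1 / 2 : ℝ) ^ (n + 1) ≤ Real.exp (-ε / h ^ (1 / s)) := by
    rw [← hn]
    refine (half_pow_ceil_le v).trans (Real.exp_le_exp.2 ?_)
    have : -ε / h ^ (1 / s) = -(ε * v) := by rw [hv]; ring
    rw [this]
    nlinarith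
  have e5 : √(Real.pi * h) = h ^ (1 / 2 : ℝ) * √Real.pi := by
    rw [Real.sqrt_mul Real.pi_pos.le, mul_comm, Real.sqrt_eq_rpow h]
  have h6 := four_mul_exp_neg_le hδ hx hh hh1
  rw [e0, mul_assoc]
  refine key.trans (mul_le_mul_of_nonneg_left ?_ hA)
  rw [e3, e5]
  calc _ ≤ 2 * Real.exp (-ε / h ^ (1 / s)) * (h ^ (1 / 2 : ℝ) * √Real.pi) +
        h ^ (1 / 2 : ℝ) * (8 / δ ^ 2 * Real.exp (-(δ ^ 2 / 2) / h)) +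
        Real.exp (-ε / h ^ (1 / s)) * (h ^ (1 / 2 : ℝ) * √Real.pi) := by gcongr
    _ = _ := by ring

/-! ### All `h > 0`, and comparison of the decay rates. -/

/-- The bound for all `h > 0`, for any rate `c` that the boundary terms allow. -/
theorem enorm_oscIntegral_le {s T c δ M : ℝ} (hs : 1 ≤ s) (hT : 1 ≤ T)
    (hc0 : 0 < c) (hc : c ≤ 2 ^ (-(s + 1))) (hδ : 0 < δ) (hM0 : 0 ≤ M)
    (hM : ∀ h : ℝ, 0 < h → h ≤ 1 →
      Real.exp (-(δ ^ 2 / 2) / h) ≤ M * Real.exp (-c / h ^ (1 / s))) :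
    ∃ C : ℝ, 0 < C ∧ ∀ (L : ℝ) (a : ℝ → ℂ), ContDiffOn ℝ ∞ a (Icc (-L) L) →
      ∀ x : ℝ, δ ≤ |x| → |x| ≤ L → ∀ h : ℝ, 0 < h →
        ‖oscIntegral h x a‖ₑ ≤
          ENNReal.ofReal (C * h ^ (1 / 2 : ℝ) * Real.exp (-c / h ^ (1 / s))) *
            gevreyNorm s T L a := by
  have hpi : 0 < √Real.pi := Real.sqrt_pos.2 Real.pi_pos
  -- The first two summands serve `h ≤ 1`; the last serves `h ≥ 1`, where `exp (-c/h^(1/s)) ≥ exp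
  -- (-c)`.
  refine ⟨3 * √Real.pi + 8 / δ ^ 2 * M + √Real.pi * Real.exp c, by positivity, ?_⟩
  set C := 3 * √Real.pi + 8 / δ ^ 2 * M + √Real.pi * Real.exp c with hC
  have hC0 : 0 < C := by positivity
  intro L a ha x hδx hxL h hh
  have hK : 0 < C * h ^ (1 / 2 : ℝ) * Real.exp (-c / h ^ (1 / s)) := by positivity
  by_cases htop : gevreyNorm s T L a = ⊤
  · rw [htop, ENNReal.mul_top (by simpa using hK)]
    exact le_top
  set A := (gevreyNorm s T L a).toReal with hAdef
  have hA : 0 ≤ A := ENNReal.toReal_nonneg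
  have hb : ∀ j, ∀ y ∈ Icc (-L) L,
      ‖iteratedDerivWithin j a (Icc (-L) L) y‖ ≤ A * (j ! : ℝ) ^ s :=
    fun j y hy => norm_iteratedDerivWithin_le_gevreyNorm hT htop hy j
  have hreal : ‖oscIntegral h x a‖ ≤
      C * h ^ (1 / 2 : ℝ) * Real.exp (-c / h ^ (1 / s)) * A := by
    rw [← norm_oscIntegral_abs]
    rcases le_total h 1 with hh1 | hh1
    · refine (norm_oscIntegral_le_of_le_one hs hA ha hb hδ hδx hxL hh hh1).trans ?_
      have h1 : Real.exp (-2 ^ (-(s + 1)) / h ^ (1 / s)) ≤ Real.exp (-c / h ^ (1 / s)) := by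
        gcongr
      calc _ ≤ A * h ^ (1 / 2 : ℝ) * (3 * √Real.pi * Real.exp (-c / h ^ (1 / s)) +
            8 / δ ^ 2 * (M * Real.exp (-c / h ^ (1 / s)))) := by
            gcongr
            exact hM h hh hh1
        _ = (3 * √Real.pi + 8 / δ ^ 2 * M) * h ^ (1 / 2 : ℝ) *
            Real.exp (-c / h ^ (1 / s)) * A := by ring
        _ ≤ _ := by
            gcongr
            rw [hC]
            linarith [mul_pos hpi (Real.exp_pos c)]
    · have h1 : ‖oscIntegral h |x| a‖ ≤ A * √(Real.pi * h) := by
        refine norm_oscIntegral_le_sqrt hA (abs_nonneg x) hh fun y hy => ?_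
        simpa using hb 0 y ⟨by linarith [hy.1], by linarith [hy.2]⟩
      have e5 : √(Real.pi * h) = h ^ (1 / 2 : ℝ) * √Real.pi := by
        rw [Real.sqrt_mul Real.pi_pos.le, mul_comm, Real.sqrt_eq_rpow h]
      have h2 : (1 : ℝ) ≤ Real.exp c * Real.exp (-c / h ^ (1 / s)) := by
        rw [← Real.exp_add, Real.one_le_exp_iff]
        have : c / h ^ (1 / s) ≤ c :=
          div_le_self hc0.le (Real.one_le_rpow hh1 (by positivity))
        rw [neg_div]
        linarith
      calc _ ≤ A * √(Real.pi * h) := h1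
        _ = √Real.pi * h ^ (1 / 2 : ℝ) * A * 1 := by rw [e5]; ring
        _ ≤ √Real.pi * h ^ (1 / 2 : ℝ) * A * (Real.exp c * Real.exp (-c / h ^ (1 / s))) := by
            gcongr
        _ = (√Real.pi * Real.exp c) * h ^ (1 / 2 : ℝ) * Real.exp (-c / h ^ (1 / s)) * A := by ring
        _ ≤ _ := by
            gcongr
            rw [hC]
            have : 0 ≤ 8 / δ ^ 2 * M := by positivity
            linarith
  rw [← ofReal_norm, ← ENNReal.ofReal_toReal htop, ← ENNReal.ofReal_mul hK.le]
  exact ENNReal.ofReal_le_ofReal hreal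

/-- For `s > 1`, exponential decay in `1 / h` is faster than that in `1 / h ^ (1 / s)`, whatever
the rates. -/
theorem exists_exp_neg_div_le {s c d : ℝ} (hs : 1 < s) (hc : 0 < c) (hd : 0 < d) :
    ∃ M : ℝ, 0 ≤ M ∧ ∀ h : ℝ, 0 < h →
      Real.exp (-d / h) ≤ M * Real.exp (-c / h ^ (1 / s)) := by
  have hs0 : 0 < s := by linarith
  -- With `v = h^(-1/s)` the claim bounds `c v - d v^s`. This is nonpositive once `v` exceeds `r =
  -- (c/d)^(1/(s-1))`, and at most `c r` before.
  refine ⟨Real.exp (c * (c / d) ^ (1 / (s - 1))), (Real.exp_pos _).le, fun h hh => ?_⟩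
  rw [← Real.exp_add, Real.exp_le_exp]
  obtain ⟨v, hv0, rfl⟩ : ∃ v : ℝ, 0 < v ∧ v ^ (-s) = h := by
    refine ⟨h ^ (-(1 / s)), by positivity, ?_⟩
    rw [← Real.rpow_mul hh.le]
    have : -(1 / s) * -s = 1 := by field_simp
    rw [this, Real.rpow_one]
  have e1 : (v ^ (-s)) ^ (1 / s) = v⁻¹ := by
    rw [← Real.rpow_mul hv0.le, ← Real.rpow_neg_one]
    congr 1
    field_simp
  have e2 : -d / v ^ (-s) = -(d * v ^ (s - 1) * v) := by
    rw [Real.rpow_neg hv0.le, Real.rpow_sub_one hv0.ne']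
    field_simp
  rw [e1, e2, div_inv_eq_mul]
  have hr : 0 < (c / d) ^ (1 / (s - 1)) := by positivity
  rcases le_total v ((c / d) ^ (1 / (s - 1))) with h1 | h1
  · have h2 : 0 ≤ d * v ^ (s - 1) * v := by positivity
    nlinarith
  · have h2 : c / d ≤ v ^ (s - 1) := by
      rw [one_div] at h1
      exact (Real.rpow_inv_le_iff_of_pos (by positivity) hv0.le (by linarith)).1 h1
    rw [div_le_iff₀ hd] at h2
    have h3 : c * v ≤ v ^ (s - 1) * d * v := by gcongr
    have : 0 ≤ c * (c / d) ^ (1 / (s - 1)) := by positivity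
    linarith

theorem proposition1p10 (s T₀ T : ℝ) (hs : 1 ≤ s) (hT₀ : 1 < T₀) (hT : 1 < T) :
    (1 < s → ∃ c : ℝ, 0 < c ∧ ∀ δ : ℝ, 0 < δ → ∃ C : ℝ, 0 < C ∧
      ∀ (L : ℝ) (a : ℝ → ℂ), MemGevrey s T₀ L a →
        ∀ x : ℝ, δ ≤ |x| → |x| ≤ L → ∀ h : ℝ, 0 < h →
          ‖oscIntegral h x a‖ₑ ≤
            ENNReal.ofReal (C * h ^ (1 / 2 : ℝ) * Real.exp (-c / h ^ (1 / s))) *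
              gevreyNorm s T L a) ∧
    (s = 1 → ∀ δ : ℝ, 0 < δ → ∃ c : ℝ, 0 < c ∧ ∃ C : ℝ, 0 < C ∧
      ∀ (L : ℝ) (a : ℝ → ℂ), MemGevrey s T₀ L a →
        ∀ x : ℝ, δ ≤ |x| → |x| ≤ L → ∀ h : ℝ, 0 < h →
          ‖oscIntegral h x a‖ₑ ≤
            ENNReal.ofReal (C * h ^ (1 / 2 : ℝ) * Real.exp (-c / h ^ (1 / s))) *
              gevreyNorm s T L a) := by
  have hε : (0 : ℝ) < 2 ^ (-(s + 1)) := by positivity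
  refine ⟨fun hs1 => ⟨2 ^ (-(s + 1)), hε, fun δ hδ => ?_⟩, fun hs1 δ hδ => ?_⟩
  · obtain ⟨M, hM0, hM⟩ := exists_exp_neg_div_le hs1 hε (show 0 < δ ^ 2 / 2 by positivity)
    obtain ⟨C, hC, H⟩ := enorm_oscIntegral_le hs hT.le hε le_rfl hδ hM0 fun h hh _ => hM h hh
    exact ⟨C, hC, fun L a ha => H L a ha.1⟩
  -- For `s = 1` both exponentials decay in `1/h`, so `c` cannot exceed the side rate `δ²/2` if `M =
  -- 1` is to do.
  · have hc : 0 < min ((2 : ℝ) ^ (-(s + 1))) (δ ^ 2 / 2) := lt_min hε (by positivity)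
    obtain ⟨C, hC, H⟩ := enorm_oscIntegral_le (M := 1) hs hT.le hc (min_le_left _ _) hδ zero_le_one
      fun h hh _ => by
        rw [one_mul, hs1, div_one, Real.rpow_one, Real.exp_le_exp]
        gcongr
        exact min_le_right _ _
    exact ⟨_, hc, C, hC, fun L a ha => H L a ha.1⟩
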